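/- Let $\mathbf{vtm} = 210201210120\cdots$ be the infinite word over $\{0,1,2\}$, indexed from $0$, that is the (unique) fixed point of the morphism $2 \to 210$, $1 \to 20$, $0 \to 1$. A string attractor of a finite word $w = w[0..n-1]$ is a set $S \subseteq \{0,1,\ldots,n-1\}$ such that every nonempty factor of $w$ has an occurrence in $w$ that touches (i.e. covers) at least one index of $S$. Then for every $n \geq 1$ the size of the smallest string attractor of the length-$n$ prefix of $\mathbf{vtm}$ is $$ \begin{cases} 1, & \text{if } n=1;\\ 2, & \text{if } n=2;\\ 3, & \text{if } 3 \leq n \leq 6;\\ 4, & \text{if } n \geq 7. \end{cases} $$ -/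

import Mathlib

/-- The prefix of length `n` of an infinite word `x`, that is `x 0, x 1, …, x (n - 1)`. -/
def wordPrefix {α : Type*} (x : ℕ → α) (n : ℕ) : List α := (List.range n).map x

/-- The extension of a map `h` from letters to words to a morphism of finite words. -/
def applyMorphism {α β : Type*} (h : α → List β) (w : List α) : List β := w.flatMap h

/-- The infinite word `x` is a fixed point of the (nonerasing) morphism `h`:
the image of each finite prefix of `x` is again a prefix of `x`. -/
def IsFixedWord {α : Type*} (h : α → List α) (x : ℕ → α) : Prop :=
  ∀ n, applyMorphism h (wordPrefix x n) =
    wordPrefix x (applyMorphism h (wordPrefix x n)).length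

/-- The morphism `2 → 210`, `1 → 20`, `0 → 1` on the alphabet `{0, 1, 2}`. -/
def vtmMorphism : Fin 3 → List (Fin 3)
  | 0 => [1]
  | 1 => [2, 0]
  | 2 => [2, 1, 0]

/-- The `k`-fold iterate of the morphism, applied to the one-letter word `2`. -/
def vtmIterate (k : ℕ) : List (Fin 3) := (applyMorphism vtmMorphism)^[k] [2]

/-- The infinite ternary word `vtm = 210201210120…`: its letter at position `n` is the letter
at position `n` of the `n`-th iterate (which has more than `n` letters, and the iterates are
prefixes of one another; see `vtmIterate_eq_wordPrefix`). -/
def vtm (n : ℕ) : Fin 3 := (vtmIterate n).getD n 0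

/-- `S` is a string attractor of the finite word `w` (indexed from `0`): `S` consists of positions
of `w`, and every nonempty factor `f` of `w` has an occurrence in `w`, say starting at position
`i`, that touches an index `s ∈ S`. -/
def IsStringAttractor {α : Type*} (w : List α) (S : Finset ℕ) : Prop :=
  (∀ s ∈ S, s < w.length) ∧
    ∀ f : List α, f ≠ [] → f <:+: w →
      ∃ i, f <+: w.drop i ∧ ∃ s ∈ S, i ≤ s ∧ s < i + f.length

/-- `k` is the size of a smallest string attractor of `w`. -/
def IsMinAttractorSize {α : Type*} (w : List α) (k : ℕ) : Prop :=
  IsLeast {m : ℕ | ∃ S : Finset ℕ, IsStringAttractor w S ∧ S.card = m} k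

theorem vtmIterate_succ (k : ℕ) :
    vtmIterate (k + 1) = applyMorphism vtmMorphism (vtmIterate k) := by
  simp only [vtmIterate, Function.iterate_succ_apply']

theorem applyMorphism_prefix {α β : Type*} (h : α → List β) {u v : List α} (huv : u <+: v) :
    applyMorphism h u <+: applyMorphism h v := by
  obtain ⟨t, rfl⟩ := huv
  exact ⟨applyMorphism h t, by simp [applyMorphism]⟩

theorem vtmIterate_prefix_succ (k : ℕ) : vtmIterate k <+: vtmIterate (k + 1) := by
  induction k with
  | zero => exact ⟨[1, 0], rfl⟩
  | succ k ih =>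
    rw [vtmIterate_succ k, vtmIterate_succ (k + 1)]
    exact applyMorphism_prefix _ ih

theorem vtmIterate_prefix {k l : ℕ} (h : k ≤ l) : vtmIterate k <+: vtmIterate l := by
  induction l, h using Nat.le_induction with
  | base => exact List.prefix_rfl
  | succ l _ ih => exact ih.trans (vtmIterate_prefix_succ l)

theorem applyMorphism_vtm_length (w : List (Fin 3)) :
    w.length ≤ (applyMorphism vtmMorphism w).length := by
  induction w with
  | nil => simp
  | cons a w ih =>
    have : 1 ≤ (vtmMorphism a).length := by fin_cases a <;> simp [vtmMorphism]
    simp only [applyMorphism, List.flatMap_cons, List.length_append, List.length_cons] at ih ⊢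
    omega

theorem lt_length_vtmIterate (k : ℕ) :
    k < (vtmIterate k).length ∧ [2] <+: vtmIterate k := by
  induction k with
  | zero => exact ⟨by decide, List.prefix_rfl⟩
  | succ k ih =>
    obtain ⟨h1, t, ht⟩ := ih
    refine ⟨?_, List.IsPrefix.trans ⟨t, ht⟩ (vtmIterate_prefix_succ k)⟩
    have h2 := applyMorphism_vtm_length t
    rw [vtmIterate_succ, ← ht]
    rw [← ht] at h1
    simp only [applyMorphism, List.flatMap_append, List.flatMap_cons, List.flatMap_nil,
      vtmMorphism, List.length_append, List.length_cons, List.length_nil] at h1 h2 ⊢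
    omega

theorem vtmIterate_eq_wordPrefix (k : ℕ) :
    vtmIterate k = wordPrefix vtm (vtmIterate k).length := by
  apply List.ext_getElem (by simp [wordPrefix])
  intro i h1 h2
  have hi := (lt_length_vtmIterate i).1
  simp only [wordPrefix, List.getElem_map, List.getElem_range, vtm,
    List.getD_eq_getElem _ _ hi]
  rcases le_total k i with h | h
  · exact (vtmIterate_prefix h).getElem h1
  · exact ((vtmIterate_prefix h).getElem hi).symm

theorem eq_wordPrefix_of_prefix {α : Type*} {x : ℕ → α} {u : List α} {n : ℕ}
    (h : u <+: wordPrefix x n) : u = wordPrefix x u.length := by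
  apply List.ext_getElem (by simp [wordPrefix])
  intro i h1 h2
  rw [h.getElem h1]
  simp [wordPrefix]

theorem wordPrefix_prefix {α : Type*} (x : ℕ → α) {m n : ℕ} (h : m ≤ n) :
    wordPrefix x m <+: wordPrefix x n := by
  obtain ⟨d, rfl⟩ := Nat.exists_eq_add_of_le h
  exact ⟨((List.range d).map fun j => m + j).map x, by simp [wordPrefix, List.range_add]⟩

/-- `vtm` is a fixed point of its morphism. -/
theorem isFixedWord_vtm : IsFixedWord vtmMorphism vtm := by
  intro n
  have h1 : wordPrefix vtm n <+: vtmIterate n := by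
    rw [vtmIterate_eq_wordPrefix n]
    exact wordPrefix_prefix _ (lt_length_vtmIterate n).1.le
  have h2 := applyMorphism_prefix vtmMorphism h1
  rw [← vtmIterate_succ, vtmIterate_eq_wordPrefix (n + 1)] at h2
  exact eq_wordPrefix_of_prefix h2

/-- `vtm` is the only fixed point of its morphism. -/
theorem eq_vtm_of_isFixedWord {x : ℕ → Fin 3} (hx : IsFixedWord vtmMorphism x) : x = vtm := by
  have h0 : x 0 = 2 := by
    have h := hx 1
    generalize hc : x 0 = c at h
    fin_cases c <;> simp [wordPrefix, applyMorphism, vtmMorphism, hc, List.range_succ] at h ⊢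
  have key : ∀ k, vtmIterate k = wordPrefix x (vtmIterate k).length := by
    intro k
    induction k with
    | zero => simp [vtmIterate, wordPrefix, h0]
    | succ k ih =>
      rw [vtmIterate_succ, ih]
      exact hx _
  funext i
  have hi := (lt_length_vtmIterate i).1
  have h := (key i).symm.trans (vtmIterate_eq_wordPrefix i)
  have h' := congrArg (fun l => l[i]?) h
  simpa [wordPrefix, hi] using h'

/-! Position `s` of `vtm` is the gap between letters `s` and `s + 1` of the Thue–Morse word, since
`vtm` is its word of shifted differences. Hence it suffices to repeat Thue–Morse factors one letter
longer than the window, which is the parameter `e = 1` of `CoversWindows`. Upper bound: under the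
Thue–Morse morphism, gap `s` becomes gap `2s + 1`, so a four-element attractor is doubled without
growing (`CoversWindows.thueMorse_double`); finitely many lengths start the induction. Lower bound:
a position meets at most `d + 1` windows of length `d + 1`, so many distinct factors force many
positions (`CoversWindows.card_le`); lengths 7 to 13 are checked exhaustively. -/

/-- Every window of `d + 1` consecutive positions below `n` has a translate below `n` that meets
`S` and on which `x` takes the same values, also at the `e` positions following the window. -/
def CoversWindows {α : Type*} (x : ℕ → α) (e n : ℕ) (S : Finset ℕ) : Prop :=
  ∀ i < n, ∀ d < n - i, ∃ j < n - d,
    (∃ s ∈ S, j ≤ s ∧ s ≤ j + d) ∧ ∀ k < d + 1 + e, x (i + k) = x (j + k)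

instance {α : Type*} [DecidableEq α] (x : ℕ → α) (e n : ℕ) (S : Finset ℕ) :
    Decidable (CoversWindows x e n S) := by
  unfold CoversWindows; infer_instance

theorem CoversWindows.congr {α : Type*} {x y : ℕ → α} {e n : ℕ} {S : Finset ℕ}
    (h : CoversWindows x e n S) (hxy : ∀ i < n + e, x i = y i) : CoversWindows y e n S := by
  intro i hi d hd
  obtain ⟨j, hj, hs, hk⟩ := h i hi d hd
  refine ⟨j, hj, hs, fun k hk' => ?_⟩
  rw [← hxy _ (by omega), ← hxy _ (by omega)]
  exact hk k hk'

theorem wordPrefix_window_prefix {α : Type*} (x : ℕ → α) {n j : ℕ} {f : List α} :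
    f <+: (wordPrefix x n).drop j ∧ f ≠ [] ↔
      f ≠ [] ∧ j + f.length ≤ n ∧ ∀ k, (hk : k < f.length) → f[k] = x (j + k) := by
  constructor
  · rintro ⟨h, hf⟩
    have hl := h.length_le
    have hp := List.length_pos_of_ne_nil hf
    simp only [wordPrefix, List.length_drop, List.length_map, List.length_range] at hl
    refine ⟨hf, by omega, fun k hk => ?_⟩
    rw [h.getElem hk]
    simp [wordPrefix]
  · rintro ⟨hf, hl, hk⟩
    refine ⟨?_, hf⟩
    rw [List.prefix_iff_eq_take]
    apply List.ext_getElem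
    · simp [wordPrefix]; omega
    · intro i h1 h2
      rw [hk i h1]
      simp [wordPrefix]

theorem isStringAttractor_wordPrefix_iff {α : Type*} (x : ℕ → α) (n : ℕ) (S : Finset ℕ) :
    IsStringAttractor (wordPrefix x n) S ↔ (∀ s ∈ S, s < n) ∧ CoversWindows x 0 n S := by
  have hlen : (wordPrefix x n).length = n := by simp [wordPrefix]
  constructor
  · rintro ⟨h1, h2⟩
    refine ⟨fun s hs => hlen ▸ h1 s hs, fun i hi d hd => ?_⟩
    let f : List α := (List.range (d + 1)).map fun k => x (i + k)
    have hfl : f.length = d + 1 := by simp [f]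
    have hf : f ≠ [] := List.ne_nil_of_length_pos (by omega)
    have hp : f <+: (wordPrefix x n).drop i :=
      ((wordPrefix_window_prefix x).2 ⟨hf, by omega, fun k hk => by simp [f]⟩).1
    obtain ⟨j, hj, s, hs, hs1, hs2⟩ := h2 f hf (hp.isInfix.trans (List.drop_suffix _ _).isInfix)
    obtain ⟨-, hl, hk⟩ := (wordPrefix_window_prefix x).1 ⟨hj, hf⟩
    refine ⟨j, by omega, ⟨s, hs, hs1, by omega⟩, fun k hk' => ?_⟩
    rw [← hk k (by omega)]
    simp [f]
  · rintro ⟨h1, h2⟩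
    refine ⟨fun s hs => hlen.symm ▸ h1 s hs, ?_⟩
    rintro f hf ⟨u, v, huv⟩
    have hp : f <+: (wordPrefix x n).drop u.length := ⟨v, by rw [← huv]; simp⟩
    obtain ⟨-, hl, hk⟩ := (wordPrefix_window_prefix x).1 ⟨hp, hf⟩
    have hpos := List.length_pos_of_ne_nil hf
    obtain ⟨j, hj, ⟨s, hs, hs1, hs2⟩, hjk⟩ :=
      h2 u.length (by omega) (f.length - 1) (by omega)
    refine ⟨j, ((wordPrefix_window_prefix x).2 ⟨hf, by omega, fun k hk' => ?_⟩).1,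
      s, hs, hs1, by omega⟩
    rw [hk k hk']
    exact hjk k (by omega)

/-! ### The Thue–Morse word and `vtm` -/

/-- The Thue–Morse sequence: the parity of the sum of the binary digits. -/
def thueMorse (n : ℕ) : Bool := Nat.binaryRec false (fun b _ r => xor b r) n

theorem thueMorse_zero : thueMorse 0 = false := by simp [thueMorse]

theorem thueMorse_bit (b : Bool) (n : ℕ) : thueMorse (Nat.bit b n) = xor b (thueMorse n) := by
  rw [thueMorse, Nat.binaryRec_eq _ _ (Or.inl rfl), thueMorse]

theorem thueMorse_two_mul (n : ℕ) : thueMorse (2 * n) = thueMorse n := by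
  simpa [Nat.bit_val] using thueMorse_bit false n

theorem thueMorse_two_mul_add_one (n : ℕ) : thueMorse (2 * n + 1) = !thueMorse n := by
  simpa [Nat.bit_val] using thueMorse_bit true n

/-- The difference `b - a`, shifted by one so as to be a letter of `{0, 1, 2}`. -/
def differenceLetter : Bool → Bool → Fin 3
  | true, false => 0
  | false, false => 1
  | true, true => 1
  | false, true => 2

/-- The word of shifted differences of the Thue–Morse sequence. -/
def thueMorseDifference (n : ℕ) : Fin 3 := differenceLetter (thueMorse n) (thueMorse (n + 1))

/-- The image of a letter `b - a + 1` has length `2 + b - a`, so the lengths telescope. -/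
theorem applyMorphism_wordPrefix_thueMorseDifference (n : ℕ) :
    applyMorphism vtmMorphism (wordPrefix thueMorseDifference n) =
      wordPrefix thueMorseDifference (2 * n + (thueMorse n).toNat) := by
  induction n with
  | zero => simp [thueMorse_zero, applyMorphism, wordPrefix]
  | succ n ih =>
    have hsucc : ∀ m, wordPrefix thueMorseDifference (m + 1) =
        wordPrefix thueMorseDifference m ++ [thueMorseDifference m] := fun m => by
      simp [wordPrefix, List.range_succ]
    have h0 := thueMorse_two_mul n
    have h1 := thueMorse_two_mul_add_one n
    have h2 := thueMorse_two_mul (n + 1)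
    have h3 := thueMorse_two_mul_add_one (n + 1)
    rw [mul_add, mul_one] at h2 h3
    rw [hsucc, applyMorphism, List.flatMap_append, ← applyMorphism, ih, thueMorseDifference]
    rcases ha : thueMorse n <;> rcases hb : thueMorse (n + 1) <;>
      simp_all [mul_add, differenceLetter, vtmMorphism, thueMorseDifference]

theorem vtm_eq_thueMorseDifference : vtm = thueMorseDifference := by
  refine (eq_vtm_of_isFixedWord fun n => ?_).symm
  rw [applyMorphism_wordPrefix_thueMorseDifference]
  simp [wordPrefix]

/-! ### Upper bound: doubling attractors -/

/-- An attractor of the Thue–Morse word contains a position of the square `bb`. -/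
theorem CoversWindows.exists_square {n : ℕ} {S : Finset ℕ} (hn : 6 ≤ n)
    (h : CoversWindows thueMorse 1 n S) (b : Bool) :
    ∃ s ∈ S, s < n ∧ thueMorse s = b ∧ thueMorse (s + 1) = b := by
  obtain ⟨i, hi, h0, h1⟩ : ∃ i < n, thueMorse i = b ∧ thueMorse (i + 1) = b := by
    cases b
    · exact ⟨5, by omega, by decide +kernel, by decide +kernel⟩
    · exact ⟨1, by omega, by decide +kernel, by decide +kernel⟩
  obtain ⟨j, hj, ⟨s, hs, hs1, hs2⟩, hk⟩ := h i hi 0 (by omega)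
  obtain rfl : s = j := by omega
  exact ⟨s, hs, by omega, (hk 0 (by omega)).symm.trans h0, (hk 1 (by omega)).symm.trans h1⟩

theorem thueMorse_eq_of_half {p j L : ℕ} (h : ∀ k ≤ L, thueMorse (p + k) = thueMorse (j + k))
    {k : ℕ} (hk : k ≤ 2 * L + 1) : thueMorse (2 * p + k) = thueMorse (2 * j + k) := by
  have hh := h (k / 2) (by omega)
  rcases Nat.even_or_odd' k with ⟨c, rfl | rfl⟩
  · rw [show 2 * c / 2 = c by omega] at hh
    rw [← mul_add, ← mul_add, thueMorse_two_mul, thueMorse_two_mul, hh]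
  · rw [show (2 * c + 1) / 2 = c by omega] at hh
    rw [← add_assoc, ← add_assoc, ← mul_add, ← mul_add, thueMorse_two_mul_add_one,
      thueMorse_two_mul_add_one, hh]

/-- An attractor for the Thue–Morse word of length `n`, and of length `m ∈ {n, n + 1}`, can be
doubled to one for the length `n + m + 1`. -/
theorem CoversWindows.thueMorse_double {n m : ℕ} {S : Finset ℕ} (hn : 6 ≤ n)
    (h : CoversWindows thueMorse 1 n S) (h' : CoversWindows thueMorse 1 m S)
    (hnm : m = n ∨ m = n + 1) :
    CoversWindows thueMorse 1 (n + m + 1) (S.image fun s => 2 * s + 1) := by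
  intro i hi d hd
  obtain hL | ⟨e, hL⟩ : (i + d + 1) / 2 = i / 2 ∨ ∃ e, (i + d + 1) / 2 = i / 2 + (e + 1) := by
    rcases Nat.eq_or_lt_of_le (show i / 2 ≤ (i + d + 1) / 2 by omega) with h | h
    · exact Or.inl h.symm
    · exact Or.inr ⟨(i + d + 1) / 2 - i / 2 - 1, by omega⟩
  -- Both letters come from a single parent, so no parent gap is available. The pair recurs astride
  -- the two images of a square of the opposite letter.
  · obtain rfl : d = 0 := by omega
    obtain ⟨c, rfl⟩ : ∃ c, i = 2 * c := ⟨i / 2, by omega⟩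
    obtain ⟨s, hs, hsn, h0, h1⟩ := h.exists_square hn (!thueMorse c)
    refine ⟨2 * s + 1, by omega, ⟨_, Finset.mem_image_of_mem _ hs, by omega, by omega⟩, ?_⟩
    intro k hk
    obtain rfl | rfl : k = 0 ∨ k = 1 := by omega
    · simp [thueMorse_two_mul, thueMorse_two_mul_add_one, h0]
    · rw [show 2 * s + 1 + 1 = 2 * (s + 1) by ring, thueMorse_two_mul,
        thueMorse_two_mul_add_one, h1]
  · obtain ⟨N, hN, hNb, hNc⟩ : ∃ N, CoversWindows thueMorse 1 N S ∧ (i + d + 1) / 2 ≤ N ∧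
        2 * N + (i + d + 1) % 2 ≤ n + m + 1 := by
      -- The translate keeps the parity of its right end. An even end may reach the image of parent
      -- letter `m`; an odd end must stay within that of letter `n`.
      by_cases hr : (i + d + 1) % 2 = 0
      · exact ⟨m, h', by omega, by omega⟩
      · exact ⟨n, h, by omega, by omega⟩
    obtain ⟨j, hj, ⟨s, hs, hs1, hs2⟩, hk⟩ := hN (i / 2) (by omega) e (by omega)
    refine ⟨2 * j + i % 2, by omega,
      ⟨_, Finset.mem_image_of_mem _ hs, by omega, by omega⟩, fun k hk' => ?_⟩
    have := thueMorse_eq_of_half (L := e + 1) (fun k hk' => hk k (by omega))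
      (k := i % 2 + k) (by omega)
    rwa [← add_assoc, ← add_assoc, Nat.div_add_mod] at this

/-- One set serves both `n` and `n + 1` because doubling to an even length uses two consecutive
parent lengths. -/
theorem exists_coversWindows_thueMorse (n : ℕ) (hn : 8 ≤ n) :
    ∃ S : Finset ℕ, S.card = 4 ∧ (∀ s ∈ S, s < n) ∧
      CoversWindows thueMorse 1 n S ∧ CoversWindows thueMorse 1 (n + 1) S := by
  induction n using Nat.strong_induction_on with
  | _ n ih =>
  -- The parent length `(n - 1) / 2` is at least 8 exactly when `n ≥ 17`.
  rcases Nat.lt_or_ge n 17 with h | h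
  · rcases Nat.lt_or_ge n 11 with h1 | h1
    · refine ⟨{2, 3, 5, 7}, rfl, ?_⟩
      interval_cases n <;> decide +kernel
    · rcases Nat.lt_or_ge n 12 with h2 | h2
      · refine ⟨{2, 3, 7, 9}, rfl, ?_⟩
        interval_cases n; decide +kernel
      · refine ⟨{3, 5, 7, 11}, rfl, ?_⟩
        interval_cases n <;> decide +kernel
  · obtain ⟨S, hc, hS, h0, h1⟩ := ih ((n - 1) / 2) (by omega) (by omega)
    generalize hm : (n - 1) / 2 = m at *
    refine ⟨S.image fun s => 2 * s + 1, ?_, ?_, ?_⟩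
    · rw [Finset.card_image_of_injective _ fun a b hab => by simpa using hab, hc]
    · intro s hs
      obtain ⟨a, ha, rfl⟩ := Finset.mem_image.1 hs
      have := hS a ha
      omega
    · have e0 := h0.thueMorse_double (by omega) h0 (Or.inl rfl)
      have e1 := h0.thueMorse_double (by omega) h1 (Or.inr rfl)
      have e2 := h1.thueMorse_double (by omega) h1 (Or.inl rfl)
      obtain rfl | rfl : n = m + m + 1 ∨ n = m + (m + 1) + 1 := by omega
      · exact ⟨e0, e1⟩
      · exact ⟨e1, by convert e2 using 1; ring⟩

theorem exists_attractor_thueMorseDifference (n : ℕ) (hn : 7 ≤ n) :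
    ∃ S : Finset ℕ, S.card = 4 ∧ (∀ s ∈ S, s < n) ∧ CoversWindows thueMorseDifference 0 n S := by
  rcases Nat.eq_or_lt_of_le hn with rfl | hn
  · exact ⟨{1, 2, 3, 5}, rfl, by decide, by decide +kernel⟩
  · obtain ⟨S, hc, hS, h, -⟩ := exists_coversWindows_thueMorse n hn
    refine ⟨S, hc, hS, fun i hi d hd => ?_⟩
    obtain ⟨j, hj, hs, hk⟩ := h i hi d hd
    refine ⟨j, hj, hs, fun k hk' => ?_⟩
    have h0 := hk k (by omega)
    have h1 := hk (k + 1) (by omega)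
    simp only [← add_assoc] at h1
    rw [thueMorseDifference, thueMorseDifference, h0, h1]

/-! ### Lower bound: counting factors -/

/-- Every letter of a covered word occurs at a position of `S`. -/
theorem CoversWindows.exists_mem_eq {α : Type*} {x : ℕ → α} {n : ℕ} {S : Finset ℕ}
    (h : CoversWindows x 0 n S) {i : ℕ} (hi : i < n) : ∃ s ∈ S, s < n ∧ x s = x i := by
  obtain ⟨j, hj, ⟨s, hs, hs1, hs2⟩, hk⟩ := h i hi 0 (by omega)
  obtain rfl : s = j := by omega
  exact ⟨s, hs, by omega, (hk 0 (by omega)).symm⟩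

/-- Windows of length `d + 1` with pairwise distinct contents number at most `(d + 1) * #S`. -/
theorem CoversWindows.card_le {α : Type*} {x : ℕ → α} {n d : ℕ} {S P : Finset ℕ}
    (h : CoversWindows x 0 n S) (hP : ∀ p ∈ P, p + d < n)
    (hinj : ∀ p ∈ P, ∀ q ∈ P, (∀ k < d + 1, x (p + k) = x (q + k)) → p = q) :
    P.card ≤ S.card * (d + 1) := by
  have key : ∀ p ∈ P, ∃ y ∈ S ×ˢ Finset.range (d + 1),
      ∀ k < d + 1, x (p + k) = x (y.1 - y.2 + k) := by
    intro p hp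
    have := hP p hp
    obtain ⟨j, hj, ⟨s, hs, hs1, hs2⟩, hk⟩ := h p (by omega) d (by omega)
    refine ⟨(s, s - j), by simp; exact ⟨hs, by omega⟩, fun k hk' => ?_⟩
    rw [hk k hk', show s - (s - j) = j by omega]
  choose! f hf hfx using key
  calc P.card ≤ (S ×ˢ Finset.range (d + 1)).card := by
        refine Finset.card_le_card_of_injOn f hf fun p hp q hq hpq => hinj p hp q hq ?_
        intro k hk
        rw [hfx p hp k hk, hfx q hq k hk, hpq]
    _ = S.card * (d + 1) := by simp

theorem two_le_card_of_coversWindows {n : ℕ} {S : Finset ℕ} (hn : 2 ≤ n)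
    (h : CoversWindows thueMorseDifference 0 n S) : 2 ≤ S.card := by
  have := h.card_le (d := 0) (P := {0, 1}) (by simp; omega) (by decide +kernel)
  simpa using this

theorem three_le_card_of_coversWindows {n : ℕ} {S : Finset ℕ} (hn : 3 ≤ n)
    (h : CoversWindows thueMorseDifference 0 n S) : 3 ≤ S.card := by
  have := h.card_le (d := 0) (P := {0, 1, 2}) (by simp; omega) (by decide +kernel)
  simpa using this

/-- A three-element attractor has one position per letter, which narrows the search. -/
theorem not_coversWindows_triple (n : ℕ) (h7 : 7 ≤ n) (h14 : n < 14) :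
    ¬ ∃ a < n, thueMorseDifference a = 0 ∧ ∃ b < n, thueMorseDifference b = 1 ∧
      ∃ c < n, thueMorseDifference c = 2 ∧ CoversWindows thueMorseDifference 0 n {a, b, c} := by
  interval_cases n <;> decide +kernel

theorem four_le_card_of_coversWindows {n : ℕ} {S : Finset ℕ} (hn : 7 ≤ n)
    (h : CoversWindows thueMorseDifference 0 n S) : 4 ≤ S.card := by
  rcases Nat.lt_or_ge n 14 with h14 | h14
  · by_contra! hc
    obtain ⟨a, ha, han, hxa⟩ := h.exists_mem_eq (i := 2) (by omega)
    obtain ⟨b, hb, hbn, hxb⟩ := h.exists_mem_eq (i := 1) (by omega)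
    obtain ⟨c, hcS, hcn, hxc⟩ := h.exists_mem_eq (i := 0) (by omega)
    rw [show thueMorseDifference 2 = 0 by decide +kernel] at hxa
    rw [show thueMorseDifference 1 = 1 by decide +kernel] at hxb
    rw [show thueMorseDifference 0 = 2 by decide +kernel] at hxc
    have hab : a ≠ b := by rintro rfl; simp [hxa] at hxb
    have hac : a ≠ c := by rintro rfl; simp [hxa] at hxc
    have hbc : b ≠ c := by rintro rfl; simp [hxb] at hxc
    have hS : ({a, b, c} : Finset ℕ) = S := by
      apply Finset.eq_of_subset_of_card_le
      · simp [Finset.insert_subset_iff, ha, hb, hcS]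
      · rw [Finset.card_eq_three.2 ⟨a, b, c, hab, hac, hbc, rfl⟩]
        omega
    subst hS
    exact not_coversWindows_triple n hn h14 ⟨a, han, hxa, b, hbn, hxb, c, hcn, hxc, h⟩
  -- These are starts of ten distinct factors of length 3, the last ending at position 13; three
  -- positions account for at most nine.
  · have := h.card_le (d := 2) (P := {0, 1, 2, 3, 4, 5, 7, 9, 10, 11})
      (by simp; omega) (by decide +kernel)
    have hP : ({0, 1, 2, 3, 4, 5, 7, 9, 10, 11} : Finset ℕ).card = 10 := rfl
    omega

theorem theorem7 (n : ℕ) (hn : 1 ≤ n) :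
    IsMinAttractorSize (wordPrefix vtm n)
      (if n = 1 then 1 else if n = 2 then 2 else if n ≤ 6 then 3 else 4) := by
  simp only [IsMinAttractorSize, vtm_eq_thueMorseDifference, isStringAttractor_wordPrefix_iff]
  constructor
  · rcases Nat.lt_or_ge n 7 with h7 | h7
    · interval_cases n
      · exact ⟨{0}, by decide +kernel⟩
      · exact ⟨{0, 1}, by decide +kernel⟩
      · exact ⟨{0, 1, 2}, by decide +kernel⟩
      · exact ⟨{0, 1, 2}, by decide +kernel⟩
      · exact ⟨{1, 2, 3}, by decide +kernel⟩
      · exact ⟨{1, 3, 4}, by decide +kernel⟩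
    · obtain ⟨S, hc, hS, h⟩ := exists_attractor_thueMorseDifference n h7
      refine ⟨S, ⟨hS, h⟩, ?_⟩
      rw [if_neg (by omega), if_neg (by omega), if_neg (by omega), hc]
  · rintro m ⟨S, ⟨-, h⟩, rfl⟩
    split_ifs with h1 h2 h6
    · obtain ⟨s, hs, -⟩ := h.exists_mem_eq hn
      exact Finset.card_pos.2 ⟨s, hs⟩
    · exact two_le_card_of_coversWindows (by omega) h
    · exact three_le_card_of_coversWindows (by omega) h
    · exact four_le_card_of_coversWindows (by omega) h
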